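/- Fix a constant $c_\star\in(0,1)$. There exist constants $c_s,c>0$, depending only on $c_\star$, such that the following holds for all integers $k,n,m$ with $2\le k\le n$ and all reals $r>0$, $\sigma\ge 0$. Let $$\Theta(k,n,r)=\Bigl\{x\in\mathbb{R}^n:\ \|x\|_2=r,\ \|x\|_0=k,\ \min_{i:\,x_i\ne 0}|x_i|\ge c_\star r/\sqrt{k}\Bigr\},$$ where $\|x\|_0$ is the number of non-zero entries of $x$. Let $A_1,\dots,A_m$ be i.i.d. $\mathcal N(0,I_n)$ random vectors and let $\varepsilon_1,\dots,\varepsilon_m$ be i.i.d. $\mathcal N(0,\sigma^2)$ random variables independent of them. For $x^\star\in\mathbb{R}^n$ let $\mathbb P_{(A,Y\mid x^\star)}$ denote the joint law of $A=(A_j)_{j\le m}$ and $Y=(Y_j)_{j\le m}$, where $Y_j=(A_j^\top x^\star)^2+\varepsilon_j$, and let $\operatorname{dist}(x^\star,x)=\min\{\|x-x^\star\|_2,\|x+x^\star\|_2\}$. If $$m\ \ge\ c_s\Bigl(1+\frac{\sigma^2}{r^4}\Bigr)k\log\Bigl(\frac{en}{k}\Bigr),$$ then $$\inf_{\widehat x}\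 \sup_{x^\star\in\Theta(k,n,r)}\ \mathbb P_{(A,Y\mid x^\star)}\biggl[\frac{\operatorname{dist}(x^\star,\widehat x)}{r}\ \ge\ \frac{c\,\sigma}{r^2}\sqrt{\frac{k}{m}}\biggr]\ \ge\ \frac15,$$ where the infimum is taken over all (measurable) estimators $\widehat x=\widehat x(A,Y)\in\mathbb{R}^n$. -/

import Mathlib

open MeasureTheory ProbabilityTheory
open scoped NNReal ENNReal

namespace SparsePhaseRetrieval

/-- The signal class `Θ(k, n, r)` with lower-bound constant `cstar`: vectors of Euclidean norm `r`
with exactly `k` non-zero entries, each of modulus at least `cstar * r / √k`. -/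
def signalClass (cstar : ℝ) (k n : ℕ) (r : ℝ) : Set (EuclideanSpace ℝ (Fin n)) :=
  {x | ‖x‖ = r ∧ {i | x i ≠ 0}.ncard = k ∧ ∀ i, x i ≠ 0 → cstar * r / √(k : ℝ) ≤ |x i|}

/-- The Euclidean distance of `y` from the solution set `{x, -x}`. -/
noncomputable def signDist {n : ℕ} (x y : EuclideanSpace ℝ (Fin n)) : ℝ :=
  min ‖y - x‖ ‖y + x‖

/-- The space of data sets `(A, Y)` made of `m` sensing vectors in `ℝⁿ` and `m` observations. -/
abbrev Data (m n : ℕ) : Type :=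
  (Fin m → EuclideanSpace ℝ (Fin n)) × (Fin m → ℝ)

/-- The data set `(A, Y)` that results from the signal `x`, the sensing vectors `p.1` and the noise
`p.2`, namely `Y j = ⟨A j, x⟩² + ε j`. -/
noncomputable def observe {m n : ℕ} (x : EuclideanSpace ℝ (Fin n)) (p : Data m n) : Data m n :=
  (p.1, fun j => (inner ℝ (p.1 j) x) ^ 2 + p.2 j)

/-- The joint law of the sensing vectors and the noise: `A 1, …, A m` are i.i.d. `N(0, Iₙ)`,
`ε 1, …, ε m` are i.i.d. `N(0, σ²)`, and the two families are independent. -/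
noncomputable def designNoiseLaw (m n : ℕ) (σ : ℝ≥0) : Measure (Data m n) :=
  (Measure.pi fun _ : Fin m => stdGaussian (EuclideanSpace ℝ (Fin n))).prod
    (Measure.pi fun _ : Fin m => gaussianReal 0 (σ ^ 2))

/-- The law of the data `(A, Y)` when the signal is `x`. -/
noncomputable def dataLaw (m : ℕ) {n : ℕ} (σ : ℝ≥0) (x : EuclideanSpace ℝ (Fin n)) :
    Measure (Data m n) :=
  (designNoiseLaw m n σ).map (observe x)

theorem measurable_observe {m n : ℕ} (x : EuclideanSpace ℝ (Fin n)) :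
    Measurable (observe x : Data m n → Data m n) := by
  unfold observe
  fun_prop

instance (m n : ℕ) (σ : ℝ≥0) : IsProbabilityMeasure (designNoiseLaw m n σ) := by
  unfold designNoiseLaw
  infer_instance

instance (m n : ℕ) (σ : ℝ≥0) (x : EuclideanSpace ℝ (Fin n)) :
    IsProbabilityMeasure (dataLaw m σ x) :=
  Measure.isProbabilityMeasure_map (measurable_observe x).aemeasurable

end SparsePhaseRetrieval

namespace SparsePhaseRetrieval

/-! With a fixed support of size `k` the problem still has about `k / 2` free parameters, and this
alone gives the rate; the logarithm in the hypothesis is only used as a factor at least 1. Pair up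
the first `k` coordinates, start from the flat signal, and let each of `p = k / 2` bits move energy
inside its pair by a relative amount `δ` of order `(σ / r²) √(k / m)`. The norm stays exactly `r`,
and the lower bound on `m` keeps `δ ≤ 1 - cstar`, so all `2 ^ p` signals lie in the class
(`cubeSignal_mem_signalClass`).

Let `S v` be the event that the estimator is within `s` of `± x v`. Each signal is compared with the
flat one `x₀` by a change of measure truncated at log-likelihood ratio `p / 20` (`dataLaw_le_add`):
`P_v (S v) ≤ 1/10 + exp (p / 20) * P_0 (S v)`. The truncation error is Chebyshev plus a
fourth-moment bound for the Gaussian design.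

For one data set, all `v` whose events hold lie in a Hamming ball of radius `p / 40`, since
distances between signals grow with Hamming distance (`le_norm_sq_cubeSignal_sub`). Hence `∑ P_0 (S
v) ≤ 1.3 ^ p` (`card_hammingBall_le`). As `exp (1 / 20) * 1.3 ≤ 1.4`, averaging over the cube gives
success probability at most `1/10 + 7/10 = 4/5`, so some signal is missed with probability at least
`1/5`. No packing set is needed. -/

/-! ### Moments of the Gaussian design -/

theorem pow_four_le_exp_add_exp_neg (x : ℝ) :
    x ^ 4 ≤ 24 * (Real.exp (1 * x) + Real.exp (-1 * x)) := by
  have h (y : ℝ) (hy : 0 ≤ y) : y ^ 4 ≤ 24 * Real.exp y := by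
    have := Real.pow_div_factorial_le_exp y hy 4
    norm_num [Nat.factorial] at this
    linarith
  rcases le_total 0 x with hx | hx
  · have := h x hx
    have h2 := Real.exp_pos (-1 * x)
    rw [one_mul]; linarith
  · have := h (-x) (by linarith)
    have h2 := Real.exp_pos (1 * x)
    rw [neg_one_mul]; nlinarith

/-- A crude bound on the fourth moment of a standard Gaussian variable. -/
theorem lintegral_pow_four_gaussianReal_le :
    ∫⁻ x, ENNReal.ofReal (x ^ 4) ∂(gaussianReal 0 1) ≤ 96 := by
  have hi1 := integrable_exp_mul_gaussianReal (μ := 0) (v := 1) 1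
  have hi2 := integrable_exp_mul_gaussianReal (μ := 0) (v := 1) (-1)
  have hm (t : ℝ) : ∫ x, Real.exp (t * x) ∂(gaussianReal 0 1) = Real.exp (t ^ 2 / 2) := by
    have := congrFun (mgf_fun_id_gaussianReal (μ := 0) (v := 1)) t
    simpa [mgf] using this
  have he : Real.exp (1 / 2) ≤ 2 := by
    have h1 := Real.exp_one_lt_d9
    have h2 : Real.exp (1 / 2) * Real.exp (1 / 2) = Real.exp 1 := by
      rw [← Real.exp_add]; norm_num
    nlinarith [Real.exp_pos (1 / 2)]
  calc ∫⁻ x, ENNReal.ofReal (x ^ 4) ∂(gaussianReal 0 1)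
      ≤ ∫⁻ x, ENNReal.ofReal (24 * (Real.exp (1 * x) + Real.exp (-1 * x)))
          ∂(gaussianReal 0 1) :=
        lintegral_mono fun x => ENNReal.ofReal_le_ofReal (pow_four_le_exp_add_exp_neg x)
    _ = ENNReal.ofReal (∫ x, 24 * (Real.exp (1 * x) + Real.exp (-1 * x)) ∂(gaussianReal 0 1)) := by
        exact (ofReal_integral_eq_lintegral_ofReal ((hi1.add hi2).const_mul 24)
          (ae_of_all _ fun x => mul_nonneg (by norm_num)
            (add_nonneg (Real.exp_pos _).le (Real.exp_pos _).le))).symm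
    _ ≤ ENNReal.ofReal 96 := by
        apply ENNReal.ofReal_le_ofReal
        rw [integral_const_mul, integral_add hi1 hi2, hm, hm]
        norm_num
        linarith
    _ = 96 := by norm_num

section Design

variable {E : Type*} [NormedAddCommGroup E] [InnerProductSpace ℝ E] [FiniteDimensional ℝ E]
  [MeasurableSpace E] [BorelSpace E]

theorem map_inner_stdGaussian {u : E} (hu : ‖u‖ = 1) :
    (stdGaussian E).map (fun a => inner ℝ a u) = gaussianReal 0 1 := by
  have h := IsGaussian.map_eq_gaussianReal (μ := stdGaussian E) (innerSL ℝ u)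
  rw [integral_strongDual_stdGaussian, variance_dual_stdGaussian, innerSL_apply_norm, hu] at h
  simp only [one_pow, Real.toNNReal_one] at h
  rw [← h]
  congr 1
  ext a
  simp [real_inner_comm]

theorem lintegral_inner_pow_four_le {u : E} (hu : ‖u‖ = 1) :
    ∫⁻ a, ENNReal.ofReal (inner ℝ a u ^ 4) ∂(stdGaussian E) ≤ 96 := by
  have h : ∫⁻ a, ENNReal.ofReal (inner ℝ a u ^ 4) ∂(stdGaussian E)
      = ∫⁻ x, ENNReal.ofReal (x ^ 4) ∂((stdGaussian E).map (fun a => inner ℝ a u)) := by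
    rw [lintegral_map (by fun_prop) (by fun_prop)]
  rw [h, map_inner_stdGaussian hu]
  exact lintegral_pow_four_gaussianReal_le

/-- After normalising both vectors, a product of squares is at most half the sum of the fourth
powers, so the one-dimensional fourth moment suffices and the correlation of the two forms plays no
role. -/
theorem lintegral_sq_inner_mul_sq_inner_le (u w : E) :
    ∫⁻ a, ENNReal.ofReal (inner ℝ a u ^ 2 * inner ℝ a w ^ 2) ∂(stdGaussian E)
      ≤ 96 * ENNReal.ofReal (‖u‖ ^ 2 * ‖w‖ ^ 2) := by
  rcases eq_or_ne u 0 with rfl | hu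
  · simp
  rcases eq_or_ne w 0 with rfl | hw
  · simp
  have hu' : 0 < ‖u‖ := norm_pos_iff.2 hu
  have hw' : 0 < ‖w‖ := norm_pos_iff.2 hw
  set u₁ := ‖u‖⁻¹ • u with hu₁
  set w₁ := ‖w‖⁻¹ • w with hw₁
  have nu : ‖u₁‖ = 1 := by rw [hu₁, norm_smul, norm_inv, norm_norm, inv_mul_cancel₀ hu'.ne']
  have nw : ‖w₁‖ = 1 := by rw [hw₁, norm_smul, norm_inv, norm_norm, inv_mul_cancel₀ hw'.ne']
  have key (a : E) : ENNReal.ofReal (inner ℝ a u ^ 2 * inner ℝ a w ^ 2) ≤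
      ENNReal.ofReal (‖u‖ ^ 2 * ‖w‖ ^ 2 / 2) *
        (ENNReal.ofReal (inner ℝ a u₁ ^ 4) + ENNReal.ofReal (inner ℝ a w₁ ^ 4)) := by
    rw [← ENNReal.ofReal_add (by positivity) (by positivity), ← ENNReal.ofReal_mul (by positivity)]
    apply ENNReal.ofReal_le_ofReal
    have e1 : inner ℝ a u = ‖u‖ * inner ℝ a u₁ := by
      rw [hu₁, inner_smul_right]; field_simp
    have e2 : inner ℝ a w = ‖w‖ * inner ℝ a w₁ := by
      rw [hw₁, inner_smul_right]; field_simp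
    rw [e1, e2]
    nlinarith [mul_nonneg (mul_nonneg (sq_nonneg ‖u‖) (sq_nonneg ‖w‖))
      (sq_nonneg (inner ℝ a u₁ ^ 2 - inner ℝ a w₁ ^ 2))]
  calc ∫⁻ a, ENNReal.ofReal (inner ℝ a u ^ 2 * inner ℝ a w ^ 2) ∂(stdGaussian E)
      ≤ ∫⁻ a, ENNReal.ofReal (‖u‖ ^ 2 * ‖w‖ ^ 2 / 2) *
        (ENNReal.ofReal (inner ℝ a u₁ ^ 4) + ENNReal.ofReal (inner ℝ a w₁ ^ 4))
          ∂(stdGaussian E) := lintegral_mono key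
    _ = ENNReal.ofReal (‖u‖ ^ 2 * ‖w‖ ^ 2 / 2) *
        (∫⁻ a, ENNReal.ofReal (inner ℝ a u₁ ^ 4) ∂(stdGaussian E) +
          ∫⁻ a, ENNReal.ofReal (inner ℝ a w₁ ^ 4) ∂(stdGaussian E)) := by
        rw [lintegral_const_mul _ (by fun_prop), lintegral_add_left (by fun_prop)]
    _ ≤ ENNReal.ofReal (‖u‖ ^ 2 * ‖w‖ ^ 2 / 2) * (96 + 96) := by
        gcongr <;> exact lintegral_inner_pow_four_le ‹_›
    _ = 96 * ENNReal.ofReal (‖u‖ ^ 2 * ‖w‖ ^ 2) := by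
        have h1 : (96 : ℝ≥0∞) = ENNReal.ofReal 96 := by norm_num
        have h2 : (96 + 96 : ℝ≥0∞) = ENNReal.ofReal 192 := by norm_num
        rw [h2, h1, ← ENNReal.ofReal_mul (by positivity), ← ENNReal.ofReal_mul (by positivity)]
        congr 1; ring

/-- The mean squared difference of the noiseless intensities of two signals. -/
theorem lintegral_sq_sub_sq_inner_le (x y : E) :
    ∫⁻ a, ENNReal.ofReal ((inner ℝ a x ^ 2 - inner ℝ a y ^ 2) ^ 2) ∂(stdGaussian E)
      ≤ 96 * ENNReal.ofReal (‖x - y‖ ^ 2 * ‖x + y‖ ^ 2) := by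
  -- The difference of squares factors into linear forms in `x - y` and `x + y`.
  refine le_trans (le_of_eq ?_) (lintegral_sq_inner_mul_sq_inner_le (x - y) (x + y))
  congr 1 with a
  rw [inner_sub_right, inner_add_right]
  congr 1; ring

end Design

/-! ### Change of measure for Gaussian shifts -/

section Noise

variable {m : ℕ}

theorem lintegral_pi_prod (μ : Fin m → Measure ℝ) [∀ j, IsProbabilityMeasure (μ j)]
    (f : Fin m → ℝ → ℝ≥0∞) (hf : ∀ j, Measurable (f j)) :
    ∫⁻ y, ∏ j, f j (y j) ∂(Measure.pi μ) = ∏ j, ∫⁻ x, f j x ∂(μ j) := by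
  have hind : iIndepFun (fun j (y : Fin m → ℝ) => f j (y j)) (Measure.pi μ) :=
    iIndepFun_pi fun j => (hf j).aemeasurable
  rw [lintegral_prod_eq_prod_lintegral_of_indepFun Finset.univ
    (fun j (y : Fin m → ℝ) => f j (y j)) hind
    fun j => (hf j).comp (measurable_pi_apply j)]
  refine Finset.prod_congr rfl fun j _ => ?_
  rw [← (measurePreserving_eval μ j).lintegral_comp (hf j)]

/-- It suffices to compare on boxes, where the indicator times the product density is again a
product and independence splits the integral. -/
theorem withDensity_pi_prod (μ : Fin m → Measure ℝ) [∀ j, IsProbabilityMeasure (μ j)]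
    (f : Fin m → ℝ → ℝ≥0∞) (hf : ∀ j, Measurable (f j))
    [∀ j, SigmaFinite ((μ j).withDensity (f j))] :
    Measure.pi (fun j => (μ j).withDensity (f j)) =
      (Measure.pi μ).withDensity fun y => ∏ j, f j (y j) := by
  refine Measure.pi_eq fun s hs => ?_
  rw [withDensity_apply _ (MeasurableSet.univ_pi hs), ← lintegral_indicator
    (MeasurableSet.univ_pi hs)]
  have h : (Set.univ.pi s).indicator (fun y => ∏ j, f j (y j)) =
      fun y : Fin m → ℝ => ∏ j, (s j).indicator (f j) (y j) := by
    ext y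
    by_cases hy : y ∈ Set.univ.pi s
    · rw [Set.indicator_of_mem hy]
      exact Finset.prod_congr rfl fun j _ => (Set.indicator_of_mem (hy j (Set.mem_univ j)) _).symm
    · rw [Set.indicator_of_notMem hy]
      simp only [Set.mem_univ_pi, not_forall] at hy
      obtain ⟨j, hj⟩ := hy
      exact (Finset.prod_eq_zero (Finset.mem_univ j) (Set.indicator_of_notMem hj _)).symm
  rw [h, lintegral_pi_prod μ _ fun j => (hf j).indicator (hs j)]
  refine Finset.prod_congr rfl fun j _ => ?_
  rw [withDensity_apply _ (hs j), lintegral_indicator (hs j)]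

theorem gaussianReal_eq_withDensity (a : ℝ) {v : ℝ≥0} (hv : v ≠ 0) :
    gaussianReal a v = (gaussianReal 0 v).withDensity
      fun y => ENNReal.ofReal (Real.exp (a * y / v - a ^ 2 / (2 * v))) := by
  rw [gaussianReal_of_var_ne_zero a hv, gaussianReal_of_var_ne_zero 0 hv,
    ← withDensity_mul _ (measurable_gaussianPDF 0 v) (by fun_prop)]
  congr 1 with y
  have hv' : (v : ℝ) ≠ 0 := by exact_mod_cast hv
  rw [Pi.mul_apply, gaussianPDF, gaussianPDF, ← ENNReal.ofReal_mul (gaussianPDFReal_nonneg _ _ _),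
    gaussianPDFReal, gaussianPDFReal, mul_assoc _ (Real.exp _), ← Real.exp_add]
  congr 3
  field_simp
  ring

theorem pi_gaussianReal_eq_withDensity (a : Fin m → ℝ) {v : ℝ≥0} (hv : v ≠ 0) :
    Measure.pi (fun j => gaussianReal (a j) v) =
      (Measure.pi fun _ : Fin m => gaussianReal 0 v).withDensity fun y =>
        ENNReal.ofReal (Real.exp (∑ j, (a j * y j / v - a j ^ 2 / (2 * v)))) := by
  have h : (fun j => gaussianReal (a j) v) = fun j => (gaussianReal 0 v).withDensity
      fun y => ENNReal.ofReal (Real.exp (a j * y / v - a j ^ 2 / (2 * v))) :=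
    funext fun j => gaussianReal_eq_withDensity (a j) hv
  have hs (j : Fin m) : SigmaFinite ((gaussianReal 0 v).withDensity
      fun y => ENNReal.ofReal (Real.exp (a j * y / v - a j ^ 2 / (2 * v)))) := by
    rw [← gaussianReal_eq_withDensity (a j) hv]; infer_instance
  rw [h, withDensity_pi_prod _ _ fun j => by fun_prop]
  congr 1 with y
  rw [Real.exp_sum, ENNReal.ofReal_prod_of_nonneg fun j _ => (Real.exp_pos _).le]

theorem map_add_pi_gaussianReal (a : Fin m → ℝ) (v : ℝ≥0) :
    (Measure.pi fun _ : Fin m => gaussianReal 0 v).map (fun y => a + y) =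
      Measure.pi fun j => gaussianReal (a j) v := by
  have h := Measure.pi_map_pi (μ := fun _ : Fin m => gaussianReal 0 v)
    (f := fun j y => a j + y) fun j => by fun_prop
  simp only [gaussianReal_map_const_add, zero_add] at h
  exact h

/-- Chebyshev's inequality for a linear form of the noise. -/
theorem pi_gaussianReal_linear_ge_le (a : Fin m → ℝ) (v : ℝ≥0) {t : ℝ} (ht : 0 < t) :
    (Measure.pi fun _ : Fin m => gaussianReal 0 v) {y | t ≤ ∑ j, a j * y j} ≤
      ENNReal.ofReal (v * (∑ j, a j ^ 2) / t ^ 2) := by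
  set μ := Measure.pi fun _ : Fin m => gaussianReal 0 v with hμ
  have hX (j : Fin m) : MemLp (fun x => a j * x) 2 (gaussianReal 0 v) :=
    (memLp_id_gaussianReal 2).const_mul _
  have hvar : Var[∑ j, fun y : Fin m → ℝ => a j * y j; μ] = v * ∑ j, a j ^ 2 := by
    rw [hμ, variance_sum_pi hX, Finset.mul_sum]
    refine Finset.sum_congr rfl fun j _ => ?_
    rw [variance_const_mul, variance_fun_id_gaussianReal]; ring
  have hXj (j : Fin m) : MemLp (fun y : Fin m → ℝ => a j * y j) 2 μ :=
    (hX j).comp_measurePreserving (measurePreserving_eval (fun _ : Fin m => gaussianReal 0 v) j)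
  have hL : MemLp (∑ j, fun y : Fin m → ℝ => a j * y j) 2 μ := memLp_finsetSum' _ fun j _ => hXj j
  have hmean : μ[∑ j, fun y : Fin m → ℝ => a j * y j] = 0 := by
    simp only [Finset.sum_apply]
    rw [integral_finsetSum _ fun j _ => (hXj j).integrable (by norm_num)]
    refine Finset.sum_eq_zero fun j _ => ?_
    have h := integral_comp_eval (μ := fun _ : Fin m => gaussianReal 0 v) (i := j)
      (f := fun x : ℝ => x) (by fun_prop)
    rw [integral_const_mul, hμ, h, integral_id_gaussianReal, mul_zero]
  have := meas_ge_le_variance_div_sq hL ht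
  rw [hvar, hmean] at this
  refine le_trans (measure_mono fun y hy => ?_) this
  simp only [Set.mem_ofPred_eq, Finset.sum_apply, sub_zero] at hy ⊢
  exact hy.trans (le_abs_self _)

/-- Under the shifted law the log-likelihood ratio has mean `S / (2v)` and variance `S / v`, where
`S = ∑ a j ^ 2`. If `S < τ v`, the mean is below `τ / 2` and Chebyshev gives `4 S / (τ² v)`;
otherwise `S / (τ v) ≥ 1` and the bound is trivial. Adding the two makes the bound linear in `S`,
ready to be averaged over a random design. -/
theorem pi_gaussianReal_logLikelihood_gt_le (a : Fin m → ℝ) {v : ℝ≥0} (hv : v ≠ 0) {τ : ℝ}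
    (hτ : 0 < τ) :
    (Measure.pi fun j => gaussianReal (a j) v)
        {y | τ < ∑ j, (a j * y j / v - a j ^ 2 / (2 * v))} ≤
      ENNReal.ofReal ((4 / τ ^ 2 + 1 / τ) / v * ∑ j, a j ^ 2) := by
  have hv' : (0 : ℝ) < v := by exact_mod_cast pos_iff_ne_zero.2 hv
  have hS : 0 ≤ ∑ j, a j ^ 2 := Finset.sum_nonneg fun j _ => sq_nonneg _
  set S := ∑ j, a j ^ 2
  rw [← map_add_pi_gaussianReal, Measure.map_apply (by fun_prop)
    (measurableSet_lt (by fun_prop) (by fun_prop))]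
  rcases le_or_gt (τ * v) S with hc | hc
  · refine prob_le_one.trans ?_
    rw [ENNReal.one_le_ofReal]
    have h1 : 1 ≤ 1 / τ / v * S := by
      rw [div_div, div_mul_eq_mul_div, one_mul, le_div_iff₀ (by positivity), one_mul]; exact hc
    have h2 : (4 / τ ^ 2 + 1 / τ) / v * S = 4 / τ ^ 2 / v * S + 1 / τ / v * S := by ring
    have h3 : 0 ≤ 4 / τ ^ 2 / v * S := by positivity
    linarith
  · refine le_trans (measure_mono (t := {y | τ * v / 2 ≤ ∑ j, a j * y j}) fun y hy => ?_)
      ((pi_gaussianReal_linear_ge_le a v (by positivity)).trans (ENNReal.ofReal_le_ofReal ?_))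
    · simp only [Set.mem_preimage, Set.mem_ofPred_eq, Pi.add_apply] at hy ⊢
      have e : ∑ j, (a j * (a j + y j) / v - a j ^ 2 / (2 * v)) =
          (∑ j, a j * y j) / v + S / (2 * v) := by
        rw [Finset.sum_div, Finset.sum_div, ← Finset.sum_add_distrib]
        refine Finset.sum_congr rfl fun j _ => ?_
        field_simp; ring
      rw [e, ← mul_lt_mul_iff_of_pos_right hv'] at hy
      have e2 : ((∑ j, a j * y j) / v + S / (2 * v)) * v = (∑ j, a j * y j) + S / 2 := by
        field_simp
      rw [e2] at hy
      linarith
    · have e : v * S / (τ * v / 2) ^ 2 = 4 / τ ^ 2 / v * S := by field_simp; norm_num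
      rw [e]
      have h2 : (4 / τ ^ 2 + 1 / τ) / v * S = 4 / τ ^ 2 / v * S + 1 / τ / v * S := by ring
      have h3 : 0 ≤ 1 / τ / v * S := by positivity
      linarith

/-- Change of measure for a Gaussian shift, truncated at the log-likelihood ratio `τ`. -/
theorem pi_gaussianReal_le_add (a : Fin m → ℝ) {v : ℝ≥0} (hv : v ≠ 0) {τ : ℝ} (hτ : 0 < τ)
    {B : Set (Fin m → ℝ)} (hB : MeasurableSet B) :
    (Measure.pi fun j => gaussianReal (a j) v) B ≤
      ENNReal.ofReal ((4 / τ ^ 2 + 1 / τ) / v * ∑ j, a j ^ 2) +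
        ENNReal.ofReal (Real.exp τ) * (Measure.pi fun _ : Fin m => gaussianReal 0 v) B := by
  set L : (Fin m → ℝ) → ℝ := fun y => ∑ j, (a j * y j / v - a j ^ 2 / (2 * v)) with hL
  have hLm : Measurable L := by fun_prop
  have hset : MeasurableSet {y | L y ≤ τ} := measurableSet_le hLm measurable_const
  calc (Measure.pi fun j => gaussianReal (a j) v) B
      ≤ (Measure.pi fun j => gaussianReal (a j) v) ({y | τ < L y} ∪ (B ∩ {y | L y ≤ τ})) :=
        measure_mono fun y hy => (lt_or_ge τ (L y)).imp id fun h => ⟨hy, h⟩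
    _ ≤ _ := measure_union_le _ _
    _ ≤ _ := by
        refine add_le_add (pi_gaussianReal_logLikelihood_gt_le a hv hτ) ?_
        rw [pi_gaussianReal_eq_withDensity a hv, withDensity_apply _ (hB.inter hset)]
        calc ∫⁻ y in B ∩ {y | L y ≤ τ}, ENNReal.ofReal (Real.exp (L y))
              ∂(Measure.pi fun _ : Fin m => gaussianReal 0 v)
            ≤ ∫⁻ _ in B ∩ {y | L y ≤ τ}, ENNReal.ofReal (Real.exp τ)
              ∂(Measure.pi fun _ : Fin m => gaussianReal 0 v) :=
              setLIntegral_mono' (hB.inter hset) fun y hy =>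
                ENNReal.ofReal_le_ofReal (Real.exp_le_exp.2 hy.2)
          _ ≤ _ := by
              rw [setLIntegral_const]
              gcongr
              exact Set.inter_subset_left

end Noise

/-! ### Change of measure between two signals -/

theorem pi_gaussianReal_le_add_pi_gaussianReal {m : ℕ} (a b : Fin m → ℝ) {v : ℝ≥0} (hv : v ≠ 0)
    {τ : ℝ} (hτ : 0 < τ) {B : Set (Fin m → ℝ)} (hB : MeasurableSet B) :
    (Measure.pi fun j => gaussianReal (a j) v) B ≤
      ENNReal.ofReal ((4 / τ ^ 2 + 1 / τ) / v * ∑ j, (a j - b j) ^ 2) +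
        ENNReal.ofReal (Real.exp τ) * (Measure.pi fun j => gaussianReal (b j) v) B := by
  have hb : Measurable fun y : Fin m → ℝ => b + y := by fun_prop
  have h := pi_gaussianReal_le_add (a - b) hv hτ (hb hB)
  rw [← map_add_pi_gaussianReal b, Measure.map_apply hb hB]
  refine le_trans (le_of_eq ?_) h
  rw [← map_add_pi_gaussianReal a, ← map_add_pi_gaussianReal (a - b),
    Measure.map_apply (by fun_prop) hB, Measure.map_apply (by fun_prop) (hb hB)]
  congr 1
  ext y
  simp only [Set.mem_preimage]
  rw [← add_assoc, add_sub_cancel]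

/-- The law of the data, disintegrated along the sensing vectors. -/
theorem dataLaw_apply {m n : ℕ} (σ : ℝ≥0) (x : EuclideanSpace ℝ (Fin n)) {S : Set (Data m n)}
    (hS : MeasurableSet S) :
    dataLaw m σ x S =
      ∫⁻ A, (Measure.pi fun j => gaussianReal (inner ℝ (A j) x ^ 2) (σ ^ 2)) (Prod.mk A ⁻¹' S)
        ∂(Measure.pi fun _ : Fin m => stdGaussian (EuclideanSpace ℝ (Fin n))) := by
  rw [dataLaw, Measure.map_apply (measurable_observe x) hS, designNoiseLaw,
    Measure.prod_apply (measurable_observe x hS)]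
  refine lintegral_congr fun A => ?_
  rw [← map_add_pi_gaussianReal fun j => inner ℝ (A j) x ^ 2,
    Measure.map_apply (by fun_prop) (measurable_prodMk_left hS)]
  rfl

/-- Change of measure between two signals, truncated at the log-likelihood ratio `τ`. -/
theorem dataLaw_le_add {m n : ℕ} {σ : ℝ≥0} (hσ : σ ≠ 0) (x y : EuclideanSpace ℝ (Fin n))
    {τ : ℝ} (hτ : 0 < τ) {S : Set (Data m n)} (hS : MeasurableSet S) :
    dataLaw m σ x S ≤
      ENNReal.ofReal ((4 / τ ^ 2 + 1 / τ) / σ ^ 2 * (96 * m * (‖x - y‖ ^ 2 * ‖x + y‖ ^ 2))) +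
        ENNReal.ofReal (Real.exp τ) * dataLaw m σ y S := by
  set K : ℝ := (4 / τ ^ 2 + 1 / τ) / σ ^ 2 with hK
  have hK0 : 0 ≤ K := by positivity
  set ν := Measure.pi fun _ : Fin m => stdGaussian (EuclideanSpace ℝ (Fin n)) with hν
  set Δ : EuclideanSpace ℝ (Fin n) → ℝ := fun a => (inner ℝ a x ^ 2 - inner ℝ a y ^ 2) ^ 2 with hΔ
  have hΔm : Measurable Δ := by fun_prop
  -- The conditional error is linear in the squared intensity differences, so its mean over the
  -- design reduces to a single sensing vector.
  have hint : ∫⁻ A, ENNReal.ofReal (K * ∑ j, Δ (A j)) ∂ν ≤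
      ENNReal.ofReal (K * (96 * m * (‖x - y‖ ^ 2 * ‖x + y‖ ^ 2))) := by
    calc ∫⁻ A, ENNReal.ofReal (K * ∑ j, Δ (A j)) ∂ν
        = ∫⁻ A, ENNReal.ofReal K * ∑ j, ENNReal.ofReal (Δ (A j)) ∂ν := by
          refine lintegral_congr fun A => ?_
          rw [ENNReal.ofReal_mul hK0, ENNReal.ofReal_sum_of_nonneg fun j _ => sq_nonneg _]
      _ = ENNReal.ofReal K * ∑ j : Fin m, ∫⁻ A, ENNReal.ofReal (Δ (A j)) ∂ν := by
          rw [lintegral_const_mul _ (by fun_prop), lintegral_finsetSum _ fun j _ => by fun_prop]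
      _ = ENNReal.ofReal K * ∑ _j : Fin m, ∫⁻ a, ENNReal.ofReal (Δ a) ∂(stdGaussian _) := by
          congr 1
          refine Finset.sum_congr rfl fun j _ => ?_
          exact (measurePreserving_eval
            (fun _ : Fin m => stdGaussian (EuclideanSpace ℝ (Fin n))) j).lintegral_comp
              (f := fun a => ENNReal.ofReal (Δ a)) (by fun_prop)
      _ ≤ ENNReal.ofReal K *
          ∑ _j : Fin m, 96 * ENNReal.ofReal (‖x - y‖ ^ 2 * ‖x + y‖ ^ 2) := by
          gcongr
          exact lintegral_sq_sub_sq_inner_le x y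
      _ = ENNReal.ofReal (K * (96 * m * (‖x - y‖ ^ 2 * ‖x + y‖ ^ 2))) := by
          rw [Finset.sum_const, Finset.card_univ, Fintype.card_fin, nsmul_eq_mul,
            ENNReal.ofReal_mul hK0, mul_assoc (96 : ℝ), ENNReal.ofReal_mul (p := 96) (by norm_num),
            ENNReal.ofReal_mul (p := m) (by positivity), ENNReal.ofReal_natCast,
            ENNReal.ofReal_ofNat]
          ring
  have hmeas : Measurable fun A : Fin m → EuclideanSpace ℝ (Fin n) => ENNReal.ofReal (K * ∑ j, Δ (A j)) := by fun_prop
  calc dataLaw m σ x S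
      ≤ ∫⁻ A, (ENNReal.ofReal (K * ∑ j, Δ (A j)) + ENNReal.ofReal (Real.exp τ) *
          (Measure.pi fun j => gaussianReal (inner ℝ (A j) y ^ 2) (σ ^ 2)) (Prod.mk A ⁻¹' S))
            ∂ν := by
        rw [dataLaw_apply σ x hS]
        refine lintegral_mono fun A => ?_
        have := pi_gaussianReal_le_add_pi_gaussianReal (fun j => inner ℝ (A j) x ^ 2)
          (fun j => inner ℝ (A j) y ^ 2) (pow_ne_zero 2 hσ) hτ (measurable_prodMk_left (x := A) hS)
        simpa [hK, hΔ] using this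
    _ = ∫⁻ A, ENNReal.ofReal (K * ∑ j, Δ (A j)) ∂ν +
          ENNReal.ofReal (Real.exp τ) * dataLaw m σ y S := by
        rw [lintegral_add_left hmeas, lintegral_const_mul' _ _ ENNReal.ofReal_ne_top,
          dataLaw_apply σ y hS]
    _ ≤ _ := by gcongr

/-! ### Volume of Hamming balls -/

/-- The weight is a product over bits, and each bit contributes `1 + 1 / 4`. -/
theorem sum_inv_four_pow_hammingDist (p : ℕ) (w : Fin p → Bool) :
    ∑ v : Fin p → Bool, (1 / 4 : ℝ) ^ hammingDist v w = (5 / 4) ^ p := by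
  have h (v : Fin p → Bool) :
      (1 / 4 : ℝ) ^ hammingDist v w = ∏ i, if v i ≠ w i then (1 / 4 : ℝ) else 1 := by
    rw [Finset.prod_ite, Finset.prod_const, Finset.prod_const_one, mul_one]
    rfl
  simp_rw [h]
  rw [← Fintype.piFinset_univ, ← Finset.prod_univ_sum (fun _ => Finset.univ)
    (fun i b => if b ≠ w i then (1 / 4 : ℝ) else 1)]
  have h2 (i : Fin p) : ∑ b : Bool, (if b ≠ w i then (1 / 4 : ℝ) else 1) = 5 / 4 := by
    cases w i <;> norm_num
  rw [Finset.prod_congr rfl fun i _ => h2 i, Finset.prod_const, Finset.card_univ, Fintype.card_fin]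

/-- The volume of a small Hamming ball. -/
theorem card_hammingBall_le (p : ℕ) (w : Fin p → Bool) :
    (({v : Fin p → Bool | 40 * hammingDist v w ≤ p} : Finset _).card : ℝ) ≤ (13 / 10) ^ p := by
  set B : Finset (Fin p → Bool) := {v : Fin p → Bool | 40 * hammingDist v w ≤ p}
  -- A Chernoff weight: it is at least 1 on the ball because `(26/25) ^ 40 ≥ 4`, and its total mass
  -- is `(26/25 * 5/4) ^ p = (13/10) ^ p`.
  have h1 : ∀ v ∈ B, (1 : ℝ) ≤ (26 / 25) ^ p * (1 / 4) ^ hammingDist v w := by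
    intro v hv
    have hv' : 40 * hammingDist v w ≤ p := (Finset.mem_filter.1 hv).2
    calc (1 : ℝ) ≤ ((26 / 25) ^ 40 * (1 / 4)) ^ hammingDist v w := one_le_pow₀ (by norm_num)
      _ = (26 / 25) ^ (40 * hammingDist v w) * (1 / 4) ^ hammingDist v w := by
          rw [mul_pow, pow_mul]
      _ ≤ _ := by
          gcongr
          norm_num
  calc (B.card : ℝ) = ∑ _v ∈ B, (1 : ℝ) := by simp
    _ ≤ ∑ v ∈ B, (26 / 25) ^ p * (1 / 4) ^ hammingDist v w := Finset.sum_le_sum h1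
    _ ≤ ∑ v, (26 / 25) ^ p * (1 / 4) ^ hammingDist v w :=
        Finset.sum_le_sum_of_subset_of_nonneg (Finset.subset_univ _) fun _ _ _ => by positivity
    _ = (13 / 10) ^ p := by
        rw [← Finset.mul_sum, sum_inv_four_pow_hammingDist, ← mul_pow]; norm_num

/-! ### Paired sign patterns -/

theorem sum_range_two_mul (g : ℕ → ℝ) (p : ℕ) :
    ∑ j ∈ Finset.range (2 * p), g j = ∑ i : Fin p, (g (2 * i) + g (2 * i + 1)) := by
  rw [Fin.sum_univ_eq_sum_range (fun i => g (2 * i) + g (2 * i + 1))]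
  induction p with
  | zero => simp
  | succ p ih =>
    rw [Finset.sum_range_succ, ← ih, mul_add, mul_one, Finset.sum_range_succ,
      Finset.sum_range_succ]
    ring

/-- The direction of perturbation of the `j`-th coordinate: a bit of `v` acts with opposite signs
on two consecutive coordinates. -/
def pairSign {p : ℕ} (v : Fin p → Bool) (j : ℕ) : ℝ :=
  if h : j / 2 < p then (if v ⟨j / 2, h⟩ then 1 else -1) * (-1) ^ j else 0

section PairSign

variable {p : ℕ} (v w : Fin p → Bool)

theorem pairSign_two_mul (i : Fin p) : pairSign v (2 * i) = if v i then 1 else -1 := by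
  have h : 2 * (i : ℕ) / 2 = i := by omega
  simp [pairSign, h, pow_mul]

theorem pairSign_two_mul_add_one (i : Fin p) :
    pairSign v (2 * i + 1) = -(if v i then 1 else -1) := by
  have h : (2 * (i : ℕ) + 1) / 2 = i := by omega
  simp [pairSign, h, pow_mul, pow_succ]

theorem pairSign_of_le {j : ℕ} (hj : 2 * p ≤ j) : pairSign v j = 0 := by
  rw [pairSign, dif_neg (by omega)]

theorem abs_pairSign_le_one (j : ℕ) : |pairSign v j| ≤ 1 := by
  unfold pairSign
  split_ifs <;> simp

theorem sum_range_of_pairs {k : ℕ} (hk : 2 * p ≤ k) (g : ℕ → ℝ) (hg : ∀ j, 2 * p ≤ j → g j = 0) :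
    ∑ j ∈ Finset.range k, g j = ∑ i : Fin p, (g (2 * i) + g (2 * i + 1)) := by
  rw [← sum_range_two_mul]
  refine (Finset.sum_subset (Finset.range_mono hk) fun j _ hj => hg j ?_).symm
  simpa using hj

/-- Opposite signs cancel within each pair; this is what keeps the norm of every cube signal equal
to `r`. -/
theorem sum_pairSign {k : ℕ} (hk : 2 * p ≤ k) : ∑ j ∈ Finset.range k, pairSign v j = 0 := by
  rw [sum_range_of_pairs hk _ fun j => pairSign_of_le v]
  simp [pairSign_two_mul, pairSign_two_mul_add_one]

/-- A flipped bit changes two coordinates by `±2` each, contributing `4 + 4`. -/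
theorem sum_sq_pairSign_sub {k : ℕ} (hk : 2 * p ≤ k) :
    ∑ j ∈ Finset.range k, (pairSign v j - pairSign w j) ^ 2 = 8 * hammingDist v w := by
  rw [sum_range_of_pairs hk _ fun j hj => by rw [pairSign_of_le v hj, pairSign_of_le w hj]; simp]
  have h (i : Fin p) : (pairSign v (2 * i) - pairSign w (2 * i)) ^ 2 +
      (pairSign v (2 * i + 1) - pairSign w (2 * i + 1)) ^ 2 = if v i ≠ w i then (8 : ℝ) else 0 := by
    rw [pairSign_two_mul, pairSign_two_mul, pairSign_two_mul_add_one, pairSign_two_mul_add_one]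
    cases v i <;> cases w i <;> norm_num
  simp_rw [h]
  rw [Finset.sum_ite, Finset.sum_const, Finset.sum_const_zero, add_zero, nsmul_eq_mul, mul_comm]
  rfl

end PairSign

/-! ### The cube of signals: membership and geometry -/

/-- The signal supported on the first `k` coordinates whose energy is perturbed by the relative
amount `δ` within each pair of coordinates, in the direction given by `v`. -/
noncomputable def cubeSignal (k n : ℕ) (r δ : ℝ) {p : ℕ} (v : Fin p → Bool) :
    EuclideanSpace ℝ (Fin n) :=
  WithLp.toLp 2 fun j => if (j : ℕ) < k then r / √k * √(1 + δ * pairSign v j) else 0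

section CubeSignal

variable {k n p : ℕ} {r δ : ℝ} (v w : Fin p → Bool)

theorem cubeSignal_apply (j : Fin n) : cubeSignal k n r δ v j =
    if (j : ℕ) < k then r / √k * √(1 + δ * pairSign v j) else 0 := rfl

theorem sum_fin_ite_lt (hkn : k ≤ n) (g : ℕ → ℝ) :
    ∑ j : Fin n, (if (j : ℕ) < k then g j else 0) = ∑ j ∈ Finset.range k, g j := by
  rw [Fin.sum_univ_eq_sum_range (fun j => if j < k then g j else 0) n, ← Finset.sum_filter]
  congr 1
  ext j
  simp only [Finset.mem_filter, Finset.mem_range]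
  omega

theorem one_sub_le_one_add_mul_pairSign (hδ : 0 ≤ δ) (j : ℕ) : 1 - δ ≤ 1 + δ * pairSign v j := by
  have := (abs_le.1 (abs_pairSign_le_one v j)).1
  nlinarith

theorem one_add_mul_pairSign_le (hδ : 0 ≤ δ) (j : ℕ) : 1 + δ * pairSign v j ≤ 1 + δ := by
  have := (abs_le.1 (abs_pairSign_le_one v j)).2
  nlinarith

theorem norm_cubeSignal (hr : 0 ≤ r) (hδ : 0 ≤ δ) (hδ1 : δ ≤ 1) (hk : 0 < k) (hkn : k ≤ n)
    (hp : 2 * p ≤ k) : ‖cubeSignal k n r δ v‖ = r := by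
  have hk' : (0 : ℝ) < k := by exact_mod_cast hk
  rw [← sq_eq_sq₀ (norm_nonneg _) hr, EuclideanSpace.norm_sq_eq]
  have h (j : Fin n) : ‖cubeSignal k n r δ v j‖ ^ 2 =
      if (j : ℕ) < k then r ^ 2 / k * (1 + δ * pairSign v j) else 0 := by
    rw [cubeSignal_apply, Real.norm_eq_abs, sq_abs]
    split_ifs
    · rw [mul_pow, div_pow, Real.sq_sqrt hk'.le, Real.sq_sqrt]
      linarith [one_sub_le_one_add_mul_pairSign v hδ j]
    · simp
  rw [Finset.sum_congr rfl fun j _ => h j, sum_fin_ite_lt hkn fun j => r ^ 2 / k * (1 + δ * pairSign v j), ← Finset.mul_sum,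
    Finset.sum_add_distrib, ← Finset.mul_sum, sum_pairSign v hp]
  simp
  field_simp

theorem cubeSignal_nonneg (hr : 0 ≤ r) (j : Fin n) : 0 ≤ cubeSignal k n r δ v j := by
  rw [cubeSignal_apply]
  split_ifs <;> positivity

theorem cubeSignal_mem_signalClass {cstar : ℝ} (hc : 0 < cstar) (hc1 : cstar < 1) (hr : 0 < r)
    (hδ : 0 ≤ δ) (hδ1 : δ ≤ 1 - cstar) (hk : 0 < k) (hkn : k ≤ n) (hp : 2 * p ≤ k) :
    cubeSignal k n r δ v ∈ signalClass cstar k n r := by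
  have hk' : (0 : ℝ) < k := by exact_mod_cast hk
  have hpos : 0 < r / √k := by positivity
  -- The radicand is at least `1 - δ ≥ cstar ≥ cstar ^ 2`.
  have hge (j : ℕ) : cstar ≤ √(1 + δ * pairSign v j) := by
    refine Real.le_sqrt_of_sq_le ?_
    nlinarith [one_sub_le_one_add_mul_pairSign v hδ j]
  have hne (j : Fin n) : cubeSignal k n r δ v j ≠ 0 ↔ (j : ℕ) < k := by
    rw [cubeSignal_apply]
    have := (mul_pos hpos (hc.trans_le (hge j))).ne'
    split_ifs with h <;> simp [h, this]
  refine ⟨norm_cubeSignal v hr.le hδ (by linarith) hk hkn hp, ?_, fun j hj => ?_⟩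
  · have h : {j : Fin n | cubeSignal k n r δ v j ≠ 0} = Set.range (Fin.castLE hkn) := by
      ext j
      rw [Fin.range_castLE]
      exact hne j
    rw [h, ← Set.image_univ, Set.ncard_image_of_injective _ (Fin.castLE_injective hkn),
      Set.ncard_univ, Nat.card_fin]
  · rw [abs_of_nonneg (cubeSignal_nonneg v hr.le j), cubeSignal_apply, if_pos ((hne j).1 hj),
      mul_div_assoc, mul_comm]
    exact mul_le_mul_of_nonneg_left (hge j) hpos.le

/-- Two amplitudes are allowed so that `δ' = 0` covers the flat reference signal. -/
theorem norm_sq_cubeSignal_sub {δ' : ℝ} (hkn : k ≤ n) :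
    ‖cubeSignal k n r δ v - cubeSignal k n r δ' w‖ ^ 2 = r ^ 2 / k *
      ∑ j ∈ Finset.range k, (√(1 + δ * pairSign v j) - √(1 + δ' * pairSign w j)) ^ 2 := by
  rw [EuclideanSpace.norm_sq_eq, Finset.mul_sum, ← sum_fin_ite_lt hkn]
  refine Finset.sum_congr rfl fun j _ => ?_
  rw [PiLp.sub_apply, cubeSignal_apply, cubeSignal_apply, Real.norm_eq_abs, sq_abs]
  split_ifs
  · rw [← mul_sub, mul_pow, div_pow, Real.sq_sqrt (Nat.cast_nonneg k)]
  · simp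

/-- Write a difference of square roots as the difference of radicands over `s + t`. Since `(s + t) ^
2 ≤ 8`, this loses a factor 8, which cancels the 8 gained per flipped bit. -/
theorem le_norm_sq_cubeSignal_sub (hδ : 0 ≤ δ) (hδ1 : δ ≤ 1) (hkn : k ≤ n) (hp : 2 * p ≤ k) :
    r ^ 2 / k * δ ^ 2 * hammingDist v w ≤ ‖cubeSignal k n r δ v - cubeSignal k n r δ w‖ ^ 2 := by
  rw [norm_sq_cubeSignal_sub v w hkn, mul_assoc]
  refine mul_le_mul_of_nonneg_left ?_ (by positivity)
  have h : δ ^ 2 * (hammingDist v w : ℝ) =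
      ∑ j ∈ Finset.range k, δ ^ 2 / 8 * (pairSign v j - pairSign w j) ^ 2 := by
    rw [← Finset.mul_sum, sum_sq_pairSign_sub v w hp]; ring
  rw [h]
  refine Finset.sum_le_sum fun j _ => ?_
  have hv1 := one_sub_le_one_add_mul_pairSign v hδ j
  have hw1 := one_sub_le_one_add_mul_pairSign w hδ j
  have hv2 := one_add_mul_pairSign_le v hδ j
  have hw2 := one_add_mul_pairSign_le w hδ j
  have hv3 := Real.sq_sqrt (show 0 ≤ 1 + δ * pairSign v j by linarith)
  have hw3 := Real.sq_sqrt (show 0 ≤ 1 + δ * pairSign w j by linarith)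
  set s := √(1 + δ * pairSign v j)
  set t := √(1 + δ * pairSign w j)
  have h1 : (s + t) ^ 2 ≤ 8 := by nlinarith [sq_nonneg (s - t)]
  have h2 : δ * (pairSign v j - pairSign w j) = (s - t) * (s + t) := by linear_combination hw3 - hv3
  have h3 : δ ^ 2 / 8 * (pairSign v j - pairSign w j) ^ 2 = (s - t) ^ 2 * ((s + t) ^ 2 / 8) := by
    rw [div_mul_eq_mul_div, ← mul_pow, h2]; ring
  rw [h3]
  exact mul_le_of_le_one_right (sq_nonneg _) (by linarith)

/-- Each square root is within `δ` of 1. This bounds the information that separates a cube signal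
from the reference. -/
theorem norm_sq_cubeSignal_sub_flat_le (hδ : 0 ≤ δ) (hδ1 : δ ≤ 1) (hk : 0 < k) (hkn : k ≤ n) :
    ‖cubeSignal k n r δ v - cubeSignal k n r 0 w‖ ^ 2 ≤ r ^ 2 * δ ^ 2 := by
  have hk' : (0 : ℝ) < k := by exact_mod_cast hk
  rw [norm_sq_cubeSignal_sub v w hkn]
  have h : ∑ j ∈ Finset.range k, (√(1 + δ * pairSign v j) - √(1 + 0 * pairSign w j)) ^ 2 ≤
      ∑ _j ∈ Finset.range k, δ ^ 2 := by
    refine Finset.sum_le_sum fun j _ => ?_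
    rw [zero_mul, add_zero, Real.sqrt_one]
    have hv1 := one_sub_le_one_add_mul_pairSign v hδ j
    have hv2 := one_add_mul_pairSign_le v hδ j
    have hv3 := Real.sq_sqrt (show 0 ≤ 1 + δ * pairSign v j by linarith)
    have hv4 := Real.sqrt_nonneg (1 + δ * pairSign v j)
    set s := √(1 + δ * pairSign v j)
    rw [← sq_abs]
    refine pow_le_pow_left₀ (abs_nonneg _) (abs_le.2 ⟨?_, ?_⟩) 2 <;> nlinarith
  calc _ ≤ r ^ 2 / k * ∑ _j ∈ Finset.range k, δ ^ 2 := by gcongr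
    _ = r ^ 2 * δ ^ 2 := by
      rw [Finset.sum_const, Finset.card_range, nsmul_eq_mul]; field_simp

/-- All entries are nonnegative, so the global sign ambiguity never brings two cube signals closer.
-/
theorem norm_cubeSignal_sub_le_norm_add (hr : 0 ≤ r) :
    ‖cubeSignal k n r δ v - cubeSignal k n r δ w‖ ≤
      ‖cubeSignal k n r δ v + cubeSignal k n r δ w‖ := by
  rw [EuclideanSpace.norm_eq, EuclideanSpace.norm_eq]
  refine Real.sqrt_le_sqrt (Finset.sum_le_sum fun j _ => ?_)
  have h1 := cubeSignal_nonneg (k := k) (δ := δ) v hr j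
  have h2 := cubeSignal_nonneg (k := k) (δ := δ) w hr j
  rw [PiLp.sub_apply, PiLp.add_apply, Real.norm_eq_abs, Real.norm_eq_abs, sq_abs, sq_abs]
  nlinarith [mul_nonneg h1 h2]

end CubeSignal

/-! ### The Fano-type argument -/

/-- A triangle inequality for each choice of the two signs; mixed signs bound `‖x + y‖`, which
dominates `‖x - y‖` by hypothesis. -/
theorem norm_sub_lt_of_signDist_lt {n : ℕ} {x y z : EuclideanSpace ℝ (Fin n)} {s : ℝ}
    (hxy : ‖x - y‖ ≤ ‖x + y‖) (hx : signDist x z < s) (hy : signDist y z < s) :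
    ‖x - y‖ < 2 * s := by
  rw [signDist, min_lt_iff] at hx hy
  rcases hx with hx | hx <;> rcases hy with hy | hy
  · have h : x - y = (z - y) - (z - x) := by abel
    rw [h]; linarith [norm_sub_le (z - y) (z - x)]
  · have h : x + y = (z + y) - (z - x) := by abel
    rw [h] at hxy; linarith [norm_sub_le (z + y) (z - x)]
  · have h : x + y = (z + x) - (z - y) := by abel
    rw [h] at hxy; linarith [norm_sub_le (z + x) (z - y)]
  · have h : x - y = (z + x) - (z + y) := by abel
    rw [h]; linarith [norm_sub_le (z + x) (z + y)]

theorem continuous_signDist {n : ℕ} (x : EuclideanSpace ℝ (Fin n)) : Continuous (signDist x) := by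
  unfold signDist
  fun_prop

theorem sum_measureReal_le {Ω ι : Type*} [MeasurableSpace Ω] [Fintype ι] (μ : Measure Ω)
    [IsProbabilityMeasure μ] {S : ι → Set Ω} (hS : ∀ i, MeasurableSet (S i)) {N : ℝ}
    (hN : ∀ ω, ∑ i, (S i).indicator (1 : Ω → ℝ) ω ≤ N) : ∑ i, μ.real (S i) ≤ N := by
  have hi (i : ι) : Integrable ((S i).indicator (1 : Ω → ℝ)) μ :=
    (integrable_const (1 : ℝ)).indicator (hS i)
  calc ∑ i, μ.real (S i) = ∫ ω, ∑ i, (S i).indicator (1 : Ω → ℝ) ω ∂μ := by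
        rw [integral_finsetSum _ fun i _ => hi i]
        exact Finset.sum_congr rfl fun i _ => (integral_indicator_one (hS i)).symm
    _ ≤ ∫ _, N ∂μ := integral_mono (integrable_finsetSum _ fun i _ => hi i)
        (integrable_const N) hN
    _ = N := by simp

theorem exp_div_twenty_mul_le {p : ℕ} (hp : 0 < p) :
    Real.exp (p / 20) * (13 / 10) ^ p ≤ 7 / 10 * 2 ^ p := by
  have he : Real.exp (1 / 20) ≤ 14 / 13 := by
    have h := Real.one_sub_le_exp_neg (1 / 20)
    rw [Real.exp_neg] at h
    have h2 := Real.exp_pos (1 / 20)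
    have h3 : (1 - 1 / 20) * Real.exp (1 / 20) ≤ 1 := by
      calc _ ≤ (Real.exp (1 / 20))⁻¹ * Real.exp (1 / 20) := by gcongr
        _ = 1 := inv_mul_cancel₀ h2.ne'
    linarith
  calc Real.exp (p / 20) * (13 / 10) ^ p = (Real.exp (1 / 20) * (13 / 10)) ^ p := by
        rw [mul_pow, ← Real.exp_nat_mul]; congr 2; ring
    _ ≤ (14 / 13 * (13 / 10)) ^ p := by gcongr
    _ = (7 / 10) ^ p * 2 ^ p := by rw [← mul_pow]; norm_num
    _ ≤ 7 / 10 * 2 ^ p := by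
        gcongr
        exact pow_le_of_le_one (by norm_num) (by norm_num) hp.ne'

/-- A Fano-type bound: no estimator can locate all signals of the cube up to accuracy `s`, as soon
as `s` is small compared with the diameter of the cube and the data carry little information. -/
theorem exists_dataLaw_cubeSignal_ge {k n m p : ℕ} {r δ s : ℝ} {σ : ℝ≥0} (hσ : σ ≠ 0) (hr : 0 < r)
    (hδ : 0 ≤ δ) (hδ1 : δ ≤ 1) (hp : 0 < p) (hpk : 2 * p ≤ k) (hkn : k ≤ n)
    (hsep : (2 * s) ^ 2 * 40 ≤ r ^ 2 / k * δ ^ 2 * p)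
    (hinfo : (4 / ((p : ℝ) / 20) ^ 2 + 1 / ((p : ℝ) / 20)) / σ ^ 2 *
      (96 * m * (r ^ 2 * δ ^ 2 * (2 * r) ^ 2)) ≤ 1 / 10)
    {xhat : Data m n → EuclideanSpace ℝ (Fin n)} (hx : Measurable xhat) :
    ∃ v : Fin p → Bool, (1 / 5 : ℝ≥0∞) ≤ dataLaw m σ (cubeSignal k n r δ v)
      {d | s ≤ signDist (cubeSignal k n r δ v) (xhat d)} := by
  have hk : 0 < k := by omega
  have hp' : (0 : ℝ) < p := by exact_mod_cast hp
  have hk' : (0 : ℝ) < k := by exact_mod_cast hk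
  set x : (Fin p → Bool) → EuclideanSpace ℝ (Fin n) := fun v => cubeSignal k n r δ v with hxdef
  set x₀ : EuclideanSpace ℝ (Fin n) := cubeSignal k n r 0 (fun _ : Fin p => true) with hx₀
  set S : (Fin p → Bool) → Set (Data m n) := fun v => {d | signDist (x v) (xhat d) < s} with hSdef
  have hS (v : Fin p → Bool) : MeasurableSet (S v) :=
    measurableSet_lt ((continuous_signDist _).measurable.comp hx) measurable_const
  have hinfo' (v : Fin p → Bool) : (dataLaw m σ (x v)).real (S v) ≤
      1 / 10 + Real.exp (p / 20) * (dataLaw m σ x₀).real (S v) := by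
    -- The level `p / 20` is linear in `p`, which keeps the truncation error small, yet `exp (p /
    -- 20)` does not outweigh the gap between `1.3 ^ p` and `2 ^ p`.
    have h := dataLaw_le_add hσ (x v) x₀ (τ := p / 20) (by positivity) (hS v)
    have hn : ‖x v + x₀‖ ≤ 2 * r := by
      refine (norm_add_le _ _).trans (le_of_eq ?_)
      rw [hxdef, hx₀, norm_cubeSignal v hr.le hδ hδ1 hk hkn hpk,
        norm_cubeSignal _ hr.le le_rfl zero_le_one hk hkn hpk]
      ring
    have hb : (4 / ((p : ℝ) / 20) ^ 2 + 1 / ((p : ℝ) / 20)) / σ ^ 2 *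
        (96 * m * (‖x v - x₀‖ ^ 2 * ‖x v + x₀‖ ^ 2)) ≤ 1 / 10 := by
      refine le_trans ?_ hinfo
      gcongr
      exact norm_sq_cubeSignal_sub_flat_le v _ hδ hδ1 hk hkn
    have h2 := h.trans (add_le_add_left (ENNReal.ofReal_le_ofReal hb) _)
    have h3 := ENNReal.toReal_mono (by finiteness) h2
    rwa [ENNReal.toReal_add (by finiteness) (by finiteness), ENNReal.toReal_mul,
      ENNReal.toReal_ofReal (by norm_num), ENNReal.toReal_ofReal (Real.exp_pos _).le] at h3
  have hball : ∑ v, (dataLaw m σ x₀).real (S v) ≤ (13 / 10) ^ p := by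
    refine sum_measureReal_le _ hS fun d => ?_
    -- If the estimate is close to one signal `w`, it can be close only to those `v` in the Hamming
    -- ball of radius `p / 40` around `w`.
    by_cases hd : ∃ w, d ∈ S w
    · obtain ⟨w, hw⟩ := hd
      refine le_trans ?_ (card_hammingBall_le p w)
      rw [← Finset.sum_boole]
      refine Finset.sum_le_sum fun v _ => ?_
      by_cases hv : d ∈ S v
      · have hlt := norm_sub_lt_of_signDist_lt (norm_cubeSignal_sub_le_norm_add v w hr.le) hv hw
        have h1 := le_norm_sq_cubeSignal_sub (r := r) v w hδ hδ1 hkn hpk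
        have h2 : ‖x v - x w‖ ^ 2 < (2 * s) ^ 2 := pow_lt_pow_left₀ hlt (norm_nonneg _) two_ne_zero
        have h3 : r ^ 2 / k * δ ^ 2 * (40 * hammingDist v w : ℝ) < r ^ 2 / k * δ ^ 2 * p := by
          have : ‖x v - x w‖ ^ 2 * 40 < (2 * s) ^ 2 * 40 := by linarith
          linarith
        have h4 : (40 * hammingDist v w : ℝ) < p := lt_of_mul_lt_mul_left h3 (by positivity)
        have h5 : 40 * hammingDist v w ≤ p := by exact_mod_cast h4.le
        simp [hv, h5]
      · rw [Set.indicator_of_notMem hv]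
        split_ifs <;> norm_num
    · push Not at hd
      rw [Finset.sum_eq_zero fun v _ => Set.indicator_of_notMem (hd v) _]
      positivity
  by_contra! hcon
  have hlarge (v : Fin p → Bool) : 4 / 5 < (dataLaw m σ (x v)).real (S v) := by
    have hc : {d | s ≤ signDist (x v) (xhat d)} = (S v)ᶜ := by
      ext d; simp [hSdef]
    have h := hcon v
    change dataLaw m σ (x v) {d | s ≤ signDist (x v) (xhat d)} < _ at h
    rw [hc] at h
    have h1 := (ENNReal.toReal_lt_toReal (by finiteness) (by finiteness)).2 h
    have h2 := probReal_compl_eq_one_sub (μ := dataLaw m σ (x v)) (hS v)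
    rw [measureReal_def] at h2
    rw [h2] at h1
    norm_num at h1
    linarith
  have hcard : ∑ _v : Fin p → Bool, (1 : ℝ) = 2 ^ p := by simp
  have hpos : (0 : ℝ) < 2 ^ p := by positivity
  have hfinal : 4 / 5 * (2 : ℝ) ^ p < 1 / 10 * 2 ^ p + 7 / 10 * 2 ^ p := by
    calc 4 / 5 * (2 : ℝ) ^ p = ∑ _v : Fin p → Bool, (4 / 5 : ℝ) := by
          rw [← hcard, Finset.mul_sum]; simp
      _ < ∑ v, (dataLaw m σ (x v)).real (S v) :=
          Finset.sum_lt_sum_of_nonempty Finset.univ_nonempty fun v _ => hlarge v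
      _ ≤ ∑ v, (1 / 10 + Real.exp (p / 20) * (dataLaw m σ x₀).real (S v)) :=
          Finset.sum_le_sum fun v _ => hinfo' v
      _ = 1 / 10 * 2 ^ p + Real.exp (p / 20) * ∑ v, (dataLaw m σ x₀).real (S v) := by
          rw [Finset.sum_add_distrib, Finset.mul_sum, ← hcard, Finset.mul_sum]; simp
      _ ≤ 1 / 10 * 2 ^ p + Real.exp (p / 20) * (13 / 10) ^ p := by gcongr
      _ ≤ 1 / 10 * 2 ^ p + 7 / 10 * 2 ^ p := by gcongr 1; exact exp_div_twenty_mul_le hp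
  linarith

/-! ### Choice of constants and conclusion -/

theorem exists_mem_signalClass_dataLaw_ge {cstar : ℝ} (hc : 0 < cstar) (hc1 : cstar < 1)
    {k n m : ℕ} {r : ℝ} {σ : ℝ≥0} (hσ : σ ≠ 0) (hr : 0 < r) (hk : 2 ≤ k) (hkn : k ≤ n)
    (hm : 1 / (1 - cstar) ^ 2 * (σ ^ 2 / r ^ 4) * k ≤ m)
    {xhat : Data m n → EuclideanSpace ℝ (Fin n)} (hx : Measurable xhat) :
    ∃ x ∈ signalClass cstar k n r, (1 / 5 : ℝ≥0∞) ≤ dataLaw m σ x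
      {d | 1 / 10 ^ 6 * σ / r ^ 2 * √((k : ℝ) / m) ≤ signDist x (xhat d) / r} := by
  have hσ' : (0 : ℝ) < σ := by exact_mod_cast pos_iff_ne_zero.2 hσ
  have hk' : (0 : ℝ) < k := by exact_mod_cast (by omega : 0 < k)
  have hc' : 0 < 1 - cstar := by linarith
  have hm' : (0 : ℝ) < m := lt_of_lt_of_le (by positivity) hm
  set q := √((k : ℝ) / m) with hq
  have hqsq : q ^ 2 = k / m := Real.sq_sqrt (by positivity)
  -- The factor `10⁻⁴` makes the information at most `1620 * 1152 / 10 ^ 8 < 1 / 10`; the radius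
  -- constant `10⁻⁶` is then small enough for the separation `160 / 10 ^ 12 ≤ 1 / (3 * 10 ^ 8)`.
  set δ : ℝ := 1 / 10 ^ 4 * (σ / r ^ 2 * q) with hδdef
  have hδ0 : 0 ≤ δ := by positivity
  -- The sample size condition enters here, to keep the perturbed signals in the class.
  have hsmall : σ / r ^ 2 * q ≤ 1 - cstar := by
    refine le_of_sq_le_sq ?_ hc'.le
    rw [mul_pow, hqsq, div_pow, ← pow_mul]
    rw [div_mul_eq_mul_div, div_mul_eq_mul_div, one_mul, div_le_iff₀ (by positivity)] at hm
    rw [← mul_div_assoc, div_le_iff₀ hm']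
    linarith
  have hδ1 : δ ≤ 1 - cstar := by rw [hδdef]; linarith
  set p := k / 2 with hpdef
  have hp : 0 < p := by omega
  have hp' : (1 : ℝ) ≤ p := by exact_mod_cast hp
  have hpk : 2 * p ≤ k := by omega
  -- The worst case is `k = 3`, `p = 1`.
  have hkp : (k : ℝ) ≤ 3 * p := by exact_mod_cast (by omega : k ≤ 3 * p)
  have hsep : (2 * (1 / 10 ^ 6 * σ / r ^ 2 * q * r)) ^ 2 * 40 ≤ r ^ 2 / k * δ ^ 2 * p := by
    have e1 : (2 * (1 / 10 ^ 6 * σ / r ^ 2 * q * r)) ^ 2 * 40 =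
        160 / 10 ^ 12 * (σ / r * q) ^ 2 := by field_simp; ring
    have e2 : r ^ 2 / k * δ ^ 2 * p = 1 / 10 ^ 8 * (σ / r * q) ^ 2 * (p / k) := by
      rw [hδdef]; field_simp
    have h3 : (1 : ℝ) / 3 ≤ p / k := by rw [div_le_div_iff₀ (by norm_num) hk']; linarith
    rw [e1, e2]
    nlinarith [sq_nonneg (σ / r * q)]
  have hinfo : (4 / ((p : ℝ) / 20) ^ 2 + 1 / ((p : ℝ) / 20)) / σ ^ 2 *
      (96 * m * (r ^ 2 * δ ^ 2 * (2 * r) ^ 2)) ≤ 1 / 10 := by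
    have e : (4 / ((p : ℝ) / 20) ^ 2 + 1 / ((p : ℝ) / 20)) / σ ^ 2 *
        (96 * m * (r ^ 2 * δ ^ 2 * (2 * r) ^ 2)) =
        (1600 / (p : ℝ) ^ 2 + 20 / p) * (384 / 10 ^ 8) * k := by
      have : δ ^ 2 = 1 / 10 ^ 8 * (σ ^ 2 / r ^ 4 * (k / m)) := by
        rw [hδdef, ← hqsq]; ring
      rw [this]; field_simp; ring
    rw [e]
    have h1 : 1600 / (p : ℝ) ^ 2 ≤ 1600 / p := by
      gcongr
      nlinarith
    calc _ ≤ (1600 / (p : ℝ) + 20 / p) * (384 / 10 ^ 8) * (3 * p) := by gcongr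
      _ ≤ 1 / 10 := by
        have h0 : (p : ℝ) ≠ 0 := by positivity
        have : (1600 / (p : ℝ) + 20 / p) * (384 / 10 ^ 8) * (3 * p) = 1620 * 1152 / 10 ^ 8 := by
          field_simp; norm_num
        rw [this]; norm_num
  obtain ⟨v, hv⟩ := exists_dataLaw_cubeSignal_ge (s := 1 / 10 ^ 6 * σ / r ^ 2 * q * r) hσ hr hδ0
    (by linarith) hp hpk hkn hsep hinfo hx
  refine ⟨_, cubeSignal_mem_signalClass v hc hc1 hr hδ0 hδ1 (by omega) hkn hpk, ?_⟩
  simpa only [le_div_iff₀ hr] using hv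

theorem one_le_log_exp_one_mul_div {k n : ℕ} (hk : 0 < k) (hkn : k ≤ n) :
    1 ≤ Real.log (Real.exp 1 * n / k) := by
  have hk' : (0 : ℝ) < k := by exact_mod_cast hk
  have hkn' : (k : ℝ) ≤ n := by exact_mod_cast hkn
  have hn : (0 : ℝ) < n := hk'.trans_le hkn'
  rw [Real.le_log_iff_exp_le (by positivity), le_div_iff₀ hk']
  gcongr

end SparsePhaseRetrieval

theorem theorem5 (cstar : ℝ) (hcstar_pos : 0 < cstar) (hcstar_lt : cstar < 1) :
    ∃ cs > (0 : ℝ), ∃ c > (0 : ℝ), ∀ (k n m : ℕ) (r : ℝ) (σ : ℝ≥0),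
      2 ≤ k → k ≤ n → 0 < r →
      cs * (1 + (σ : ℝ) ^ 2 / r ^ 4) * k * Real.log (Real.exp 1 * n / k) ≤ m →
      (1 / 5 : ℝ≥0∞) ≤
        ⨅ (xhat : SparsePhaseRetrieval.Data m n → EuclideanSpace ℝ (Fin n))
          (_ : Measurable xhat),
          ⨆ x ∈ SparsePhaseRetrieval.signalClass cstar k n r,
            SparsePhaseRetrieval.dataLaw m σ x
              {d | c * σ / r ^ 2 * √((k : ℝ) / m) ≤
                SparsePhaseRetrieval.signDist x (xhat d) / r} := by
  have hc' : 0 < 1 - cstar := by linarith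
  refine ⟨1 / (1 - cstar) ^ 2, by positivity, 1 / 10 ^ 6, by positivity, ?_⟩
  intro k n m r σ hk hkn hr hm
  refine le_iInf₂ fun xhat hx => ?_
  -- Without noise the threshold is 0 and the event is everything; only nonemptiness of the class
  -- matters, and the flat signal (`p = 0`, `δ = 0`) shows it.
  rcases eq_or_ne σ 0 with rfl | hσ
  · have hmem := SparsePhaseRetrieval.cubeSignal_mem_signalClass (k := k) (n := n) (p := 0) (r := r)
      (δ := 0) (fun _ => true) hcstar_pos hcstar_lt hr le_rfl hc'.le (by omega) hkn (by omega)
    refine le_iSup₂_of_le _ hmem ?_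
    have h : {d | (1 : ℝ) / 10 ^ 6 * ((0 : ℝ≥0) : ℝ) / r ^ 2 * √((k : ℝ) / m) ≤
        SparsePhaseRetrieval.signDist (SparsePhaseRetrieval.cubeSignal k n r 0
          (fun _ : Fin 0 => true)) (xhat d) / r} = Set.univ := by
      refine Set.eq_univ_of_forall fun d => ?_
      simp only [NNReal.coe_zero, mul_zero, zero_div, zero_mul, Set.mem_ofPred_eq]
      exact div_nonneg (le_min (norm_nonneg _) (norm_nonneg _)) hr.le
    rw [h, measure_univ]
    norm_num
  · have hlog := SparsePhaseRetrieval.one_le_log_exp_one_mul_div (by omega : 0 < k) hkn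
    have hm' : 1 / (1 - cstar) ^ 2 * ((σ : ℝ) ^ 2 / r ^ 4) * k ≤ m := by
      calc 1 / (1 - cstar) ^ 2 * ((σ : ℝ) ^ 2 / r ^ 4) * k
          ≤ 1 / (1 - cstar) ^ 2 * (1 + (σ : ℝ) ^ 2 / r ^ 4) * k := by gcongr; linarith
        _ ≤ 1 / (1 - cstar) ^ 2 * (1 + (σ : ℝ) ^ 2 / r ^ 4) * k *
            Real.log (Real.exp 1 * n / k) := le_mul_of_one_le_right (by positivity) hlog
        _ ≤ m := hm
    obtain ⟨x, hxm, hxp⟩ := SparsePhaseRetrieval.exists_mem_signalClass_dataLaw_ge hcstar_pos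
      hcstar_lt hσ hr hk hkn hm' hx
    exact le_iSup₂_of_le x hxm hxp
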